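/- Let $X,Y$ be Polish spaces with their Borel $\sigma$-fields, let $d\ge 1$, and let $c:X\times Y\to[0,\infty]$ be continuous. For a $d$-tuple $\boldsymbol\mu=(\mu_1,\dots,\mu_d)$ of Borel probability measures on $X$ put $\bar\mu=\frac1d\sum_{j}\mu_j$, $\boldsymbol\mu'=\left(\frac{\mathrm d\mu_1}{\mathrm d\bar\mu},\dots,\frac{\mathrm d\mu_d}{\mathrm d\bar\mu}\right)$, and let $m_{\boldsymbol\mu}$ be the law of $\boldsymbol\mu'$ under $\bar\mu$ (a probability measure on $\mathbb R^d$ carried by $\mathbb R_+^d$). Let $\{\mu_{\mathbf z}\}$ be a disintegration of $\bar\mu$ along $\boldsymbol\mu'$, that is, a measurable family of probability measures on $X$ such that $\mu_{\mathbf z}$ is concentrated on $A_{\mathbf z}=\{x:\boldsymbol\mu'(x)=\mathbf z\}$ for $m_{\boldsymbol\mu}$-a.e. $\mathbf z$ and $\int_X f\,\mathrm d\bar\mu=\int\int_{A_{\mathbf z}}f\,\mathrm d\mu_{\mathbf z}\,m_{\boldsymbol\mu}(\mathrm d\mathbf z)$ for all measurable $f\ge 0$. Define $\bar\nu,\boldsymbol\nu',m_{\boldsymbol\nu},\{\nu_{\mathbf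 z}\}$ in the same way for a $d$-tuple $\boldsymbol\nu$ of Borel probability measures on $Y$. Let $\mathcal K(\boldsymbol\mu,\boldsymbol\nu)$ be the set of stochastic kernels $\kappa$ from $X$ to $Y$ with $\int_X\kappa(x;\cdot)\,\mu_j(\mathrm dx)=\nu_j$ for every $j$; let $\mathcal C(\kappa)=\int c\,\mathrm d(\bar\mu\otimes\kappa)$ and $\mathcal I_c(\boldsymbol\mu,\boldsymbol\nu)=\inf_{\kappa\in\mathcal K(\boldsymbol\mu,\boldsymbol\nu)}\mathcal C(\kappa)$ (with $\inf\emptyset=\infty$). For single probability measures, $\mathcal K(\mu_{\mathbf z},\nu_{\mathbf z})$ and $\mathcal I_c(\mu_{\mathbf z},\nu_{\mathbf z})$ are the case $d=1$ (with reference measure $\mu_{\mathbf z}$). A kernel in $\mathcal K$ is an optimal transport if its cost equals the infimum $\mathcal I_c$. **Theorem (Decomposition of two-way transport).** Suppose that $m_{\boldsymbol\mu}=m_{\boldsymbol\nu}=P$. Then $\mathbf z\mapsto\mathcal I_c(\mu_{\mathbf z},\nu_{\mathbf z})$ is $P$-a.e. equal to a measurable function, and every $\kappa\in\mathcal K(\boldsymbol\mu,\boldsymbol\nu)$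 satisfies $\kappa\in\mathcal K(\mu_{\mathbf z},\nu_{\mathbf z})$ for $P$-a.e. $\mathbf z$. Moreover, for such $\kappa$, consider the statements (i) $\kappa$ is an optimal transport from $\boldsymbol\mu$ to $\boldsymbol\nu$; (ii) $\kappa$ is an optimal transport from $\mu_{\mathbf z}$ to $\nu_{\mathbf z}$ for $P$-a.e. $\mathbf z$; (iii) $\mathcal C(\kappa)=\int_{\mathbb R_+^d}\mathcal I_c(\mu_{\mathbf z},\nu_{\mathbf z})\,P(\mathrm d\mathbf z)$. Then (i) and (iii) are equivalent and (ii) implies both; if $\mathcal I_c(\boldsymbol\mu,\boldsymbol\nu)<\infty$, then (i), (ii) and (iii) are equivalent. In particular, $$\mathcal I_c(\boldsymbol\mu,\boldsymbol\nu)=\int_{\mathbb R_+^d}\mathcal I_c(\mu_{\mathbf z},\nu_{\mathbf z})\,P(\mathrm d\mathbf z),$$ also when the two sides are infinite. -/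

import Mathlib

open MeasureTheory ProbabilityTheory
open scoped ENNReal

noncomputable section

namespace SOT

variable {X Y : Type*} [MeasurableSpace X] [MeasurableSpace Y] {d : ℕ}

/-- The normalized average `(∑ j, μ j) / (∑ j, μ j (X))` of a tuple of measures. -/
def avg (μ : Fin d → Measure X) : Measure X :=
  (∑ j, μ j Set.univ)⁻¹ • ∑ j, μ j

/-- The vector of Radon-Nikodym derivatives of the components of `μ` with respect to the
normalized average of `μ`. -/
def density (μ : Fin d → Measure X) (x : X) : Fin d → ℝ :=
  fun j => ((μ j).rnDeriv (avg μ) x).toReal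

/-- The law of the density vector under the normalized average. -/
def densityLaw (μ : Fin d → Measure X) : Measure (Fin d → ℝ) :=
  (avg μ).map (density μ)

/-- The class of `d`-tuples of probability measures on `X` whose density vector has law `P`. -/
def eqvClass (X : Type*) [MeasurableSpace X] (P : Measure (Fin d → ℝ)) :
    Set (Fin d → Measure X) :=
  {μ | (∀ j, IsProbabilityMeasure (μ j)) ∧ densityLaw μ = P}

/-- The slice on which the density vector equals `z`. -/
def slice (μ : Fin d → Measure X) (z : Fin d → ℝ) : Set X :=
  {x | density μ x = z}

/-- `μz` is a disintegration of the normalized average of `μ` along the density vector: a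
measurable family of probability measures, concentrated on the slices for almost every value,
whose mixture is the normalized average. -/
structure IsDisintegration (μ : Fin d → Measure X) (μz : Kernel (Fin d → ℝ) X) : Prop where
  markov : IsMarkovKernel μz
  concentrated : ∀ᵐ z ∂(densityLaw μ), μz z (slice μ z)ᶜ = 0
  lintegral_eq : ∀ f : X → ℝ≥0∞, Measurable f →
    ∫⁻ x, f x ∂(avg μ) = ∫⁻ z, ∫⁻ x in slice μ z, f x ∂(μz z) ∂(densityLaw μ)

/-- The cost of a stochastic kernel `κ` with reference measure `η`: the integral of `c` against
`η ⊗ κ`. -/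
def cost (c : X × Y → ℝ≥0∞) (η : Measure X) (κ : Kernel X Y) : ℝ≥0∞ :=
  ∫⁻ p, c p ∂(η ⊗ₘ κ)

/-- Stochastic kernels transporting the probability measure `μ` to the probability measure `ν`. -/
def transports (μ : Measure X) (ν : Measure Y) : Set (Kernel X Y) :=
  {κ | IsMarkovKernel κ ∧ κ ∘ₘ μ = ν}

/-- The minimum transport cost between two probability measures (`∞` if there is no transport). -/
def minCost (c : X × Y → ℝ≥0∞) (μ : Measure X) (ν : Measure Y) : ℝ≥0∞ :=
  ⨅ κ ∈ transports μ ν, cost c μ κ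

/-- `κ` is an optimal transport between two probability measures. -/
def IsOptimal (c : X × Y → ℝ≥0∞) (μ : Measure X) (ν : Measure Y) (κ : Kernel X Y) : Prop :=
  κ ∈ transports μ ν ∧ cost c μ κ = minCost c μ ν

/-- Stochastic kernels transporting every component `μ j` to `ν j` simultaneously (tuples of
probability measures, so the transport is balanced). -/
def simTransports (μ : Fin d → Measure X) (ν : Fin d → Measure Y) : Set (Kernel X Y) :=
  {κ | IsMarkovKernel κ ∧ ∀ j, κ ∘ₘ μ j = ν j}

/-- The minimum simultaneous transport cost, the reference measure being the normalized average
of the source tuple (`∞` if there is no simultaneous transport). -/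
def simMinCost (c : X × Y → ℝ≥0∞) (μ : Fin d → Measure X) (ν : Fin d → Measure Y) : ℝ≥0∞ :=
  ⨅ κ ∈ simTransports μ ν, cost c (avg μ) κ

/-- `κ` is an optimal simultaneous transport. -/
def IsSimOptimal (c : X × Y → ℝ≥0∞) (μ : Fin d → Measure X) (ν : Fin d → Measure Y)
    (κ : Kernel X Y) : Prop :=
  κ ∈ simTransports μ ν ∧ cost c (avg μ) κ = simMinCost c μ ν

end SOT

end

noncomputable section

namespace SOT

open scoped NNReal
open TopologicalSpace

/-- The lexicographic infimum of a sequence of functions over a set. -/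
def lexInf {K : Type*} (A : Set K) (φ : ℕ → K → ℝ≥0∞) : ℕ → ℝ≥0∞
  | n => ⨅ k ∈ {k | k ∈ A ∧ ∀ i : Fin n, φ i k = lexInf A φ i}, φ n k
decreasing_by exact i.2

theorem lexInf_eq {K : Type*} (A : Set K) (φ : ℕ → K → ℝ≥0∞) (n : ℕ) :
    lexInf A φ n = ⨅ k ∈ {k | k ∈ A ∧ ∀ i : Fin n, φ i k = lexInf A φ i}, φ n k := by
  rw [lexInf]

theorem lexInf_le {K : Type*} {A : Set K} {φ : ℕ → K → ℝ≥0∞} {n : ℕ} {k : K} (hk : k ∈ A)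
    (h : ∀ i : Fin n, φ i k = lexInf A φ i) : lexInf A φ n ≤ φ n k := by
  rw [lexInf_eq]
  exact iInf₂_le k ⟨hk, h⟩

section Compact

variable {K : Type*} [TopologicalSpace K] {A : Set K} {φ : ℕ → K → ℝ≥0∞}

theorem isClosed_lexLevel (hA : IsClosed A) (hφ : ∀ n, Continuous (φ n)) (n : ℕ) :
    IsClosed {k | k ∈ A ∧ ∀ i : Fin n, φ i k = lexInf A φ i} := by
  simp only [Set.ofPred_and, Set.ofPred_forall]
  exact hA.inter (isClosed_iInter fun i => isClosed_eq (hφ i) continuous_const)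

variable [CompactSpace K]

theorem nonempty_lexLevel (hA : IsClosed A) (hφ : ∀ n, Continuous (φ n)) (hne : A.Nonempty)
    (n : ℕ) : {k | k ∈ A ∧ ∀ i : Fin n, φ i k = lexInf A φ i}.Nonempty := by
  induction n with
  | zero => exact hne.imp fun k hk => ⟨hk, fun i => i.elim0⟩
  | succ n ih =>
    obtain ⟨k, hk, hmin⟩ := (isClosed_lexLevel hA hφ n).isCompact.exists_isMinOn ih
      (hφ n).continuousOn
    refine ⟨k, hk.1, fun i => ?_⟩
    rcases (Nat.lt_succ_iff_lt_or_eq.1 i.2) with h | h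
    · exact hk.2 ⟨i, h⟩
    · rw [h]
      refine le_antisymm ?_ (lexInf_le hk.1 hk.2)
      rw [lexInf_eq]
      exact le_iInf₂ fun l hl => hmin hl

theorem exists_eq_lexInf (hA : IsClosed A) (hφ : ∀ n, Continuous (φ n)) (hne : A.Nonempty) :
    ∃ k ∈ A, ∀ n, φ n k = lexInf A φ n := by
  obtain ⟨k, hk⟩ := IsCompact.nonempty_iInter_of_sequence_nonempty_isCompact_isClosed
    (fun n => {k | k ∈ A ∧ ∀ i : Fin n, φ i k = lexInf A φ i})
    (fun n k hk => ⟨hk.1, fun i => hk.2 i.castSucc⟩) (nonempty_lexLevel hA hφ hne)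
    (isClosed_lexLevel hA hφ 0).isCompact (isClosed_lexLevel hA hφ)
  rw [Set.mem_iInter] at hk
  exact ⟨k, (hk 0).1, fun n => (hk (n + 1)).2 (Fin.last n)⟩

/-- The lexicographic infimum over the sections of a closed set depends measurably on the
parameter. -/
theorem measurable_lexInf {Z T : Type*} [MeasurableSpace Z] [TopologicalSpace T]
    [SecondCountableTopology T] [MeasurableSpace T] [OpensMeasurableSpace T] {F : Set (T × K)}
    (hF : IsClosed F) (hφ : ∀ n, Continuous (φ n)) {g : Z → T} (hg : Measurable g)
    (hne : ∀ z, ∃ k, (g z, k) ∈ F) (n : ℕ) :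
    Measurable fun z => lexInf {k | (g z, k) ∈ F} φ n := by
  induction n using Nat.strong_induction_on with
  | _ n ih =>
  have hcl : ∀ z, IsClosed {k | (g z, k) ∈ F} := fun z =>
    hF.preimage (Continuous.prodMk_right (g z))
  refine measurable_of_Iic fun a => ?_
  let G : Set ((T × (Fin n → ℝ≥0∞)) × K) :=
    {p | (p.1.1, p.2) ∈ F ∧ (∀ i : Fin n, φ i p.2 = p.1.2 i) ∧ φ n p.2 ≤ a}
  have hG : IsClosed G := by
    simp only [G, Set.ofPred_and, Set.ofPred_forall]
    refine (hF.preimage (by fun_prop)).inter ((isClosed_iInter fun i => ?_).inter ?_)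
    · exact isClosed_eq ((hφ i).comp continuous_snd) (by fun_prop)
    · exact isClosed_le ((hφ n).comp continuous_snd) continuous_const
  have hm : Measurable fun z => (g z, fun i : Fin n => lexInf {k | (g z, k) ∈ F} φ i) :=
    hg.prodMk (measurable_pi_lambda _ fun i => ih i i.2)
  convert hm ((isClosedMap_fst_of_compactSpace G hG).measurableSet) using 1
  ext z
  simp only [Set.mem_preimage, Set.mem_Iic, Set.mem_image, Prod.exists, exists_and_right,
    exists_eq_right]
  constructor
  · intro h
    obtain ⟨k, hk, hk'⟩ := exists_eq_lexInf (hcl z) hφ (hne z)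
    exact ⟨k, hk, fun i => hk' i, (hk' n).trans_le h⟩
  · rintro ⟨k, hk, hk', hle⟩
    exact (lexInf_le (A := {k | (g z, k) ∈ F}) hk hk').trans hle

/-- A measurable selection from the sections of a closed set with compact fibres, which moreover
minimizes the first test function. -/
theorem exists_measurable_selection {Z T : Type*} [MeasurableSpace Z] [TopologicalSpace T]
    [SecondCountableTopology T] [MeasurableSpace T] [OpensMeasurableSpace T] {F : Set (T × K)}
    (hF : IsClosed F) (hφ : ∀ n, Continuous (φ n)) {g : Z → T} (hg : Measurable g)
    (hne : ∀ z, ∃ k, (g z, k) ∈ F) :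
    ∃ s : Z → K, (∀ z, (g z, s z) ∈ F) ∧ (∀ n, Measurable fun z => φ n (s z)) ∧
      ∀ z k, (g z, k) ∈ F → φ 0 (s z) ≤ φ 0 k := by
  choose s hs hs' using fun z => exists_eq_lexInf (A := {k | (g z, k) ∈ F}) (φ := φ)
    (hF.preimage (Continuous.prodMk_right (g z))) hφ (hne z)
  refine ⟨s, hs, fun n => ?_, fun z k hk => ?_⟩
  · simp only [hs']
    exact measurable_lexInf hF hφ hg hne n
  · rw [hs']
    exact lexInf_le hk fun i => i.elim0

end Compact

theorem isPiSystem_isClopen {Ω : Type*} [TopologicalSpace Ω] :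
    IsPiSystem {s : Set Ω | IsClopen s} :=
  fun _ hs _ ht _ => IsClopen.inter hs ht

theorem continuous_measure_isClopen {Ω : Type*} [TopologicalSpace Ω] [CompactSpace Ω]
    [MeasurableSpace Ω] [BorelSpace Ω] {s : Set Ω} (hs : IsClopen s) :
    Continuous fun ρ : ProbabilityMeasure Ω => (ρ : Measure Ω) s := by
  let f : C(Ω, ℝ≥0) := ⟨s.indicator 1, hs.continuous_indicator continuous_one⟩
  convert ProbabilityMeasure.continuous_lintegral_continuousMap f using 2 with ρ
  have : ∀ x, ((f x : ℝ≥0) : ℝ≥0∞) = s.indicator 1 x := fun x => by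
    by_cases hx : x ∈ s <;> simp [f, hx]
  simp only [this]
  rw [lintegral_indicator_one hs.isOpen.measurableSet]

section ZeroDim

variable {Ω : Type*} [TopologicalSpace Ω] [CompactSpace Ω] [T2Space Ω]
  [SecondCountableTopology Ω] [TotallyDisconnectedSpace Ω] [MeasurableSpace Ω] [BorelSpace Ω]

theorem generateFrom_isClopen : ‹MeasurableSpace Ω› = .generateFrom {s | IsClopen s} := by
  rw [‹BorelSpace Ω›.measurable_eq]
  exact isTopologicalBasis_isClopen.borel_eq_generateFrom

theorem ext_of_isClopen {ρ σ : Measure Ω} [IsProbabilityMeasure ρ] [IsProbabilityMeasure σ]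
    (h : ∀ s : Clopens Ω, ρ s = σ s) : ρ = σ :=
  ext_of_generate_finite _ generateFrom_isClopen isPiSystem_isClopen
    (fun s hs => h ⟨s, hs⟩) (by simp)

/-- Measurable selection of optimal couplings on a compact zero-dimensional space, the cost being
the supremum of an increasing sequence of continuous functions. -/
theorem exists_optimal_coupling_of_zeroDim {Z : Type*} [MeasurableSpace Z] (m n : Kernel Z Ω)
    [IsMarkovKernel m] [IsMarkovKernel n] {C : Ω × Ω → ℝ≥0∞} {G : ℕ → C(Ω × Ω, ℝ≥0)}
    (hG : Monotone G) (hC : ∀ p, C p = ⨆ k, (G k p : ℝ≥0∞)) :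
    ∃ π : Kernel Z (Ω × Ω), IsMarkovKernel π ∧ (∀ z, (π z).fst = m z) ∧ (∀ z, (π z).snd = n z) ∧
      ∀ z, ∀ ρ : Measure (Ω × Ω), ρ.fst = m z → ρ.snd = n z → ∫⁻ p, C p ∂(π z) ≤ ∫⁻ p, C p ∂ρ := by
  have : Countable (Clopens Ω) := Clopens.countable_iff_secondCountable.2 inferInstance
  have : Countable (Clopens (Ω × Ω)) := Clopens.countable_iff_secondCountable.2 inferInstance
  obtain ⟨D, hD⟩ := exists_surjective_nat (Clopens (Ω × Ω))
  have hCle : ∀ (ρ : Measure (Ω × Ω)) (a : ℝ≥0∞),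
      ∫⁻ p, C p ∂ρ ≤ a ↔ ∀ k, ∫⁻ p, G k p ∂ρ ≤ a := fun ρ a => by
    simp only [hC]
    rw [lintegral_iSup (fun k => (G k).continuous.measurable.coe_nnreal_ennreal)
      (fun i j hij p => ENNReal.coe_le_coe.2 (hG hij p)), iSup_le_iff]
  let φ : ℕ → ProbabilityMeasure (Ω × Ω) × ℝ≥0∞ → ℝ≥0∞
    | 0 => fun q => q.2
    | i + 1 => fun q => (q.1 : Measure (Ω × Ω)) (D i)
  let F : Set (((Clopens Ω → ℝ≥0∞) × (Clopens Ω → ℝ≥0∞)) × ProbabilityMeasure (Ω × Ω) × ℝ≥0∞) :=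
    {q | (∀ s : Clopens Ω, (q.2.1 : Measure (Ω × Ω)) (Prod.fst ⁻¹' s) = q.1.1 s) ∧
      (∀ s : Clopens Ω, (q.2.1 : Measure (Ω × Ω)) (Prod.snd ⁻¹' s) = q.1.2 s) ∧
      ∀ k, ∫⁻ p, G k p ∂(q.2.1 : Measure (Ω × Ω)) ≤ q.2.2}
  have hcl1 : ∀ s : Clopens Ω, IsClopen (Prod.fst ⁻¹' (s : Set Ω) : Set (Ω × Ω)) := fun s =>
    s.isClopen.preimage continuous_fst
  have hcl2 : ∀ s : Clopens Ω, IsClopen (Prod.snd ⁻¹' (s : Set Ω) : Set (Ω × Ω)) := fun s =>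
    s.isClopen.preimage continuous_snd
  have hF : IsClosed F := by
    simp only [F, Set.ofPred_and, Set.ofPred_forall]
    refine (isClosed_iInter fun s => ?_).inter ((isClosed_iInter fun s => ?_).inter
      (isClosed_iInter fun k => ?_))
    · exact isClosed_eq ((continuous_measure_isClopen (hcl1 s)).comp (by fun_prop)) (by fun_prop)
    · exact isClosed_eq ((continuous_measure_isClopen (hcl2 s)).comp (by fun_prop)) (by fun_prop)
    · exact isClosed_le ((ProbabilityMeasure.continuous_lintegral_continuousMap (G k)).comp
        (by fun_prop)) (by fun_prop)
  have hφ : ∀ i, Continuous (φ i) := by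
    rintro (_ | i)
    · exact continuous_snd
    · exact (continuous_measure_isClopen (D i).isClopen).comp continuous_fst
  let g : Z → (Clopens Ω → ℝ≥0∞) × (Clopens Ω → ℝ≥0∞) := fun z => (fun s => m z s, fun s => n z s)
  have hg : Measurable g :=
    (measurable_pi_lambda _ fun s => m.measurable_coe s.isClopen.isOpen.measurableSet).prodMk
      (measurable_pi_lambda _ fun s => n.measurable_coe s.isClopen.isOpen.measurableSet)
  have hmem : ∀ z (ρ : ProbabilityMeasure (Ω × Ω)) (a : ℝ≥0∞), (g z, (ρ, a)) ∈ F ↔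
      (ρ : Measure (Ω × Ω)).fst = m z ∧ (ρ : Measure (Ω × Ω)).snd = n z ∧
        ∫⁻ p, C p ∂(ρ : Measure (Ω × Ω)) ≤ a := fun z ρ a => by
    rw [hCle]
    refine and_congr ⟨fun h => ext_of_isClopen fun s => ?_, fun h s => ?_⟩
      (and_congr ⟨fun h => ext_of_isClopen fun s => ?_, fun h s => ?_⟩ Iff.rfl)
    · rw [Measure.fst_apply s.isClopen.isOpen.measurableSet]; exact h s
    · rw [← Measure.fst_apply s.isClopen.isOpen.measurableSet, h]
    · rw [Measure.snd_apply s.isClopen.isOpen.measurableSet]; exact h s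
    · rw [← Measure.snd_apply s.isClopen.isOpen.measurableSet, h]
  have hne : ∀ z, ∃ q, (g z, q) ∈ F := fun z =>
    ⟨(⟨(m z).prod (n z), inferInstance⟩, ∞), (hmem z _ _).2 ⟨by simp, by simp, le_top⟩⟩
  obtain ⟨s, hs, hsm, hmin⟩ := exists_measurable_selection hF hφ hg hne
  have hs' := fun z => (hmem z (s z).1 (s z).2).1 (hs z)
  refine ⟨⟨fun z => ((s z).1 : Measure (Ω × Ω)), ?_⟩, ⟨fun z => ?_⟩, fun z => (hs' z).1,
    fun z => (hs' z).2.1, fun z ρ h1 h2 => (hs' z).2.2.trans ?_⟩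
  · refine .measure_of_isPiSystem_of_isProbabilityMeasure generateFrom_isClopen
      isPiSystem_isClopen fun t ht => ?_
    obtain ⟨i, hi⟩ := hD ⟨t, ht⟩
    convert hsm (i + 1) using 2 with z
    simp [φ, hi]
  · exact inferInstanceAs (IsProbabilityMeasure ((s z).1 : Measure (Ω × Ω)))
  · have hρ : IsProbabilityMeasure ρ :=
      ⟨by rw [← Measure.fst_univ, h1]; exact measure_univ⟩
    exact hmin z (⟨ρ, hρ⟩, ∫⁻ p, C p ∂ρ) ((hmem z _ _).2 ⟨h1, h2, le_rfl⟩)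

end ZeroDim

section Code

/-- The sequence of memberships of a point in a sequence of sets. -/
def code {X : Type*} (U : ℕ → Set X) (x : X) : ℕ → Bool :=
  open Classical in fun n => decide (x ∈ U n)

theorem code_eq_true_iff {X : Type*} {U : ℕ → Set X} {x : X} {n : ℕ} :
    code U x n = true ↔ x ∈ U n := by
  simp [code]

theorem exists_nat_basis (X : Type*) [TopologicalSpace X] [SecondCountableTopology X] :
    ∃ U : ℕ → Set X, IsTopologicalBasis (Set.range U) := by
  obtain ⟨b, hbc, -, hb⟩ := exists_countable_basis X
  obtain ⟨U, hU⟩ := (hbc.insert ∅).exists_eq_range (Set.insert_nonempty _ _)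
  exact ⟨U, hU ▸ hb.insert_empty⟩

theorem measurableEmbedding_code {X : Type*} [TopologicalSpace X] [PolishSpace X]
    [MeasurableSpace X] [BorelSpace X] {U : ℕ → Set X} (hU : IsTopologicalBasis (Set.range U)) :
    MeasurableEmbedding (code U) := by
  refine Measurable.measurableEmbedding (measurable_pi_lambda _ fun n => ?_) fun x y hxy => ?_
  · refine measurable_to_bool ?_
    convert (hU.isOpen ⟨n, rfl⟩).measurableSet
    ext x
    exact code_eq_true_iff
  · refine (hU.inseparable_iff.2 ?_).eq
    rintro _ ⟨n, rfl⟩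
    rw [← code_eq_true_iff, ← code_eq_true_iff, hxy]

/-- The continuous function with value `r` on the cylinder where coordinates `i` and `j` are
`true`, and `0` elsewhere. -/
def cylinderFun (i j : ℕ) (r : ℝ≥0) : C((ℕ → Bool) × (ℕ → Bool), ℝ≥0) where
  toFun p := if p.1 i && p.2 j then r else 0
  continuous_toFun := by
    have h : Continuous fun b : Bool × Bool => if b.1 && b.2 then r else 0 :=
      continuous_of_discreteTopology
    have h' : Continuous fun p : (ℕ → Bool) × (ℕ → Bool) => (p.1 i, p.2 j) := by fun_prop
    exact h.comp h'

theorem iSup_partialSups_apply {α : Type*} [TopologicalSpace α] (g : ℕ → C(α, ℝ≥0)) (p : α) :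
    ⨆ k, ((partialSups g k p : ℝ≥0) : ℝ≥0∞) = ⨆ k, (g k p : ℝ≥0∞) := by
  refine le_antisymm (iSup_le fun k => ?_)
    (iSup_mono fun k => ENNReal.coe_le_coe.2 (le_partialSups g k p))
  induction k with
  | zero =>
    rw [partialSups_zero]
    exact le_iSup (fun k => (g k p : ℝ≥0∞)) 0
  | succ k ih =>
    rw [partialSups_add_one, ContinuousMap.sup_apply, ENNReal.coe_max]
    exact max_le ih (le_iSup (fun k => (g k p : ℝ≥0∞)) (k + 1))

/-- A lower semicontinuous cost on a product of Polish spaces becomes, after encoding the factors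
in the Cantor space, the supremum of an increasing sequence of continuous functions. -/
theorem exists_code {X Y : Type*} [TopologicalSpace X] [PolishSpace X] [MeasurableSpace X]
    [BorelSpace X] [TopologicalSpace Y] [PolishSpace Y] [MeasurableSpace Y] [BorelSpace Y]
    {c : X × Y → ℝ≥0∞} (hc : LowerSemicontinuous c) :
    ∃ (e : X → ℕ → Bool) (e' : Y → ℕ → Bool) (G : ℕ → C((ℕ → Bool) × (ℕ → Bool), ℝ≥0)),
      MeasurableEmbedding e ∧ MeasurableEmbedding e' ∧ Monotone G ∧
        ∀ x y, c (x, y) = ⨆ k, (G k (e x, e' y) : ℝ≥0∞) := by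
  classical
  obtain ⟨U, hU⟩ := exists_nat_basis X
  obtain ⟨V, hV⟩ := exists_nat_basis Y
  let g : ℕ × ℕ × ℚ → C((ℕ → Bool) × (ℕ → Bool), ℝ≥0) := fun k =>
    if ∀ x ∈ U k.1, ∀ y ∈ V k.2.1, (Real.toNNReal k.2.2 : ℝ≥0∞) ≤ c (x, y) then
      cylinderFun k.1 k.2.1 (Real.toNNReal k.2.2) else 0
  obtain ⟨f, hf⟩ := exists_surjective_nat (ℕ × ℕ × ℚ)
  refine ⟨code U, code V, partialSups (g ∘ f), measurableEmbedding_code hU,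
    measurableEmbedding_code hV, (partialSups (g ∘ f)).monotone, fun x y => ?_⟩
  rw [iSup_partialSups_apply]
  refine le_antisymm (le_of_forall_lt fun a ha => ?_) (iSup_le fun k => ?_)
  · obtain ⟨q, -, haq, hqc⟩ := ENNReal.lt_iff_exists_rat_btwn.1 ha
    obtain ⟨_, ⟨_, ⟨i, rfl⟩, _, ⟨j, rfl⟩, rfl⟩, hxy, hsub⟩ :=
      (hU.prod hV).mem_nhds_iff.1 (hc (x, y) _ hqc)
    obtain ⟨k, hk⟩ := hf (i, j, q)
    refine haq.trans_le (le_iSup_of_le k ?_)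
    have hcond : ∀ x ∈ U i, ∀ y ∈ V j, (Real.toNNReal q : ℝ≥0∞) ≤ c (x, y) := fun x hx y hy =>
      le_of_lt (hsub (Set.mk_mem_prod hx hy))
    have : g (f k) = cylinderFun i j (Real.toNNReal q) := by
      rw [hk]; exact if_pos hcond
    have h1 : code U x i = true := code_eq_true_iff.2 hxy.1
    have h2 : code V y j = true := code_eq_true_iff.2 hxy.2
    simp [this, cylinderFun, h1, h2]
  · simp only [Function.comp_apply, g]
    split_ifs with h
    · simp only [cylinderFun, ContinuousMap.coe_mk, Bool.and_eq_true, code_eq_true_iff]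
      split_ifs with h'
      · exact h x h'.1 y h'.2
      · simp
    · simp

/-- Measurable selection of optimal couplings for a lower semicontinuous cost. -/
theorem exists_optimal_coupling {X Y Z : Type*} [TopologicalSpace X] [PolishSpace X]
    [MeasurableSpace X] [BorelSpace X] [TopologicalSpace Y] [PolishSpace Y] [MeasurableSpace Y]
    [BorelSpace Y] [MeasurableSpace Z] {c : X × Y → ℝ≥0∞} (hc : LowerSemicontinuous c)
    (m : Kernel Z X) (n : Kernel Z Y) [IsMarkovKernel m] [IsMarkovKernel n] :
    ∃ π : Kernel Z (X × Y), IsMarkovKernel π ∧ (∀ z, (π z).fst = m z) ∧ (∀ z, (π z).snd = n z) ∧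
      ∀ z, ∀ ρ : Measure (X × Y), ρ.fst = m z → ρ.snd = n z →
        ∫⁻ p, c p ∂(π z) ≤ ∫⁻ p, c p ∂ρ := by
  obtain ⟨e, e', G, he, he', hG, hcG⟩ := exists_code hc
  have hE := he.prodMap he'
  have hm := Kernel.IsMarkovKernel.map m he.measurable
  have hn := Kernel.IsMarkovKernel.map n he'.measurable
  let C : (ℕ → Bool) × (ℕ → Bool) → ℝ≥0∞ := fun p => ⨆ k, (G k p : ℝ≥0∞)
  have hCm : Measurable C := Measurable.iSup fun k => (G k).continuous.measurable.coe_nnreal_ennreal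
  have hcC : ∀ p : X × Y, c p = C (Prod.map e e' p) := fun p => hcG p.1 p.2
  have hint : ∀ ρ : Measure (X × Y), ∫⁻ p, C p ∂(ρ.map (Prod.map e e')) = ∫⁻ p, c p ∂ρ :=
    fun ρ => by
      rw [lintegral_map hCm hE.measurable]
      simp only [hcC]
  have hfst : ∀ ρ : Measure (X × Y), (ρ.map (Prod.map e e')).fst = ρ.fst.map e := fun ρ => by
    rw [Measure.fst, Measure.fst, Measure.map_map measurable_fst hE.measurable,
      Measure.map_map he.measurable measurable_fst]
    rfl
  have hsnd : ∀ ρ : Measure (X × Y), (ρ.map (Prod.map e e')).snd = ρ.snd.map e' := fun ρ => by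
    rw [Measure.snd, Measure.snd, Measure.map_map measurable_snd hE.measurable,
      Measure.map_map he'.measurable measurable_snd]
    rfl
  obtain ⟨π, hπ, h1, h2, hmin⟩ := exists_optimal_coupling_of_zeroDim (m.map e) (n.map e') hG
    (C := C) fun _ => rfl
  simp only [Kernel.map_apply _ he.measurable, Kernel.map_apply _ he'.measurable] at h1 h2 hmin
  have hmap : ∀ z, (π.comapRight hE z).map (Prod.map e e') = π z := fun z => by
    rw [Kernel.comapRight_apply, hE.map_comap]
    refine Measure.restrict_eq_self_of_ae_mem ?_
    have ha : ∀ᵐ p ∂(π z), p.1 ∈ Set.range e := by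
      refine ae_of_ae_map measurable_fst.aemeasurable ?_
      change ∀ᵐ p ∂(π z).fst, p ∈ Set.range e
      rw [h1, he.ae_map_iff]
      exact ae_of_all _ fun x => ⟨x, rfl⟩
    have hb : ∀ᵐ p ∂(π z), p.2 ∈ Set.range e' := by
      refine ae_of_ae_map measurable_snd.aemeasurable ?_
      change ∀ᵐ p ∂(π z).snd, p ∈ Set.range e'
      rw [h2, he'.ae_map_iff]
      exact ae_of_all _ fun x => ⟨x, rfl⟩
    filter_upwards [ha, hb] with p hp hp'
    rw [Set.range_prodMap]
    exact ⟨hp, hp'⟩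
  refine ⟨π.comapRight hE, ⟨fun z => ⟨?_⟩⟩, fun z => ?_, fun z => ?_, fun z ρ hρ hρ' => ?_⟩
  · have := congrArg (fun ρ => ρ Set.univ) (hmap z)
    rw [hE.map_apply, Set.preimage_univ] at this
    exact this.trans measure_univ
  · rw [← he.comap_map (π.comapRight hE z).fst, ← hfst, hmap, h1, he.comap_map]
  · rw [← he'.comap_map (π.comapRight hE z).snd, ← hsnd, hmap, h2, he'.comap_map]
  · rw [← hint, ← hint, hmap]
    exact hmin z _ (by rw [hfst, hρ]) (by rw [hsnd, hρ'])

end Code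

section MinCost

variable {X Y Z : Type*} [TopologicalSpace X] [PolishSpace X]
    [MeasurableSpace X] [BorelSpace X] [TopologicalSpace Y] [PolishSpace Y] [MeasurableSpace Y]
    [BorelSpace Y] [MeasurableSpace Z] {c : X × Y → ℝ≥0∞}

theorem minCost_le_lintegral {X Y : Type*} [MeasurableSpace X] [MeasurableSpace Y]
    [StandardBorelSpace Y] [Nonempty Y] {μ : Measure X} {ν : Measure Y} (c : X × Y → ℝ≥0∞)
    {ρ : Measure (X × Y)} [IsFiniteMeasure ρ] (h1 : ρ.fst = μ) (h2 : ρ.snd = ν) :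
    minCost c μ ν ≤ ∫⁻ p, c p ∂ρ := by
  have hρ : μ ⊗ₘ ρ.condKernel = ρ := by rw [← h1]; exact ρ.disintegrate _
  have : IsFiniteMeasure μ := h1 ▸ inferInstance
  refine (iInf₂_le (f := fun κ (_ : κ ∈ transports μ ν) => cost c μ κ) ρ.condKernel
    ⟨inferInstance, ?_⟩).trans_eq ?_
  · rw [← Measure.snd_compProd, hρ, h2]
  · simp only [cost, hρ]

/-- Measurable selection of couplings of minimal cost. -/
theorem exists_coupling_lintegral_eq_minCost (hc : LowerSemicontinuous c)
    (m : Kernel Z X) (n : Kernel Z Y) [IsMarkovKernel m] [IsMarkovKernel n] :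
    ∃ π : Kernel Z (X × Y), IsMarkovKernel π ∧ (∀ z, (π z).fst = m z) ∧ (∀ z, (π z).snd = n z) ∧
      ∀ z, ∫⁻ p, c p ∂(π z) = minCost c (m z) (n z) := by
  obtain ⟨π, hπ, h1, h2, hmin⟩ := exists_optimal_coupling hc m n
  refine ⟨π, hπ, h1, h2, fun z => le_antisymm (le_iInf₂ fun κ hκ => ?_) ?_⟩
  · have := hκ.1
    exact hmin z _ (Measure.fst_compProd _ _) ((Measure.snd_compProd _ _).trans hκ.2)
  · have : Nonempty Y := (n z).nonempty_of_neZero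
    exact minCost_le_lintegral c (h1 z) (h2 z)

end MinCost

section Tuple

variable {X Y : Type*} [MeasurableSpace X] [MeasurableSpace Y] {d : ℕ}

theorem avg_eq_smul (μ : Fin d → Measure X) [∀ j, IsProbabilityMeasure (μ j)] :
    avg μ = (d : ℝ≥0∞)⁻¹ • ∑ j, μ j := by
  simp [avg]

theorem smul_avg (hd : 1 ≤ d) (μ : Fin d → Measure X) [∀ j, IsProbabilityMeasure (μ j)] :
    (d : ℝ≥0∞) • avg μ = ∑ j, μ j := by
  rw [avg_eq_smul, smul_smul, ENNReal.mul_inv_cancel (by simp; lia) (by simp), one_smul]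

theorem isProbabilityMeasure_avg (hd : 1 ≤ d) (μ : Fin d → Measure X)
    [∀ j, IsProbabilityMeasure (μ j)] : IsProbabilityMeasure (avg μ) := by
  refine ⟨?_⟩
  rw [avg_eq_smul]
  simp [ENNReal.inv_mul_cancel (a := (d : ℝ≥0∞)) (by simp; lia) (by simp)]

theorem le_smul_avg (hd : 1 ≤ d) (μ : Fin d → Measure X) [∀ j, IsProbabilityMeasure (μ j)]
    (j : Fin d) : μ j ≤ (d : ℝ≥0∞) • avg μ := by
  rw [smul_avg hd]
  refine Measure.le_iff.2 fun s _ => ?_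
  rw [Measure.finsetSum_apply]
  exact Finset.single_le_sum_of_canonicallyOrdered (f := fun j => μ j s) (Finset.mem_univ j)

theorem absolutelyContinuous_avg (hd : 1 ≤ d) (μ : Fin d → Measure X)
    [∀ j, IsProbabilityMeasure (μ j)] (j : Fin d) : μ j ≪ avg μ :=
  (Measure.absolutelyContinuous_of_le (le_smul_avg hd μ j)).trans
    Measure.smul_absolutelyContinuous

@[fun_prop]
theorem measurable_density (μ : Fin d → Measure X) : Measurable (density μ) :=
  measurable_pi_lambda _ fun j => ((μ j).measurable_rnDeriv (avg μ)).ennreal_toReal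

@[fun_prop]
theorem measurable_ofReal_density (μ : Fin d → Measure X) (j : Fin d) :
    Measurable fun x => ENNReal.ofReal (density μ x j) := by
  have := measurable_density μ
  fun_prop

theorem withDensity_density (hd : 1 ≤ d) (μ : Fin d → Measure X)
    [∀ j, IsProbabilityMeasure (μ j)] (j : Fin d) :
    (avg μ).withDensity (fun x => ENNReal.ofReal (density μ x j)) = μ j := by
  have := isProbabilityMeasure_avg hd μ
  refine (withDensity_congr_ae ?_).trans
    (Measure.withDensity_rnDeriv_eq _ _ (absolutelyContinuous_avg hd μ j))
  filter_upwards [(μ j).rnDeriv_lt_top (avg μ)] with x hx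
  exact ENNReal.ofReal_toReal hx.ne

theorem lintegral_density_mul (hd : 1 ≤ d) (μ : Fin d → Measure X)
    [∀ j, IsProbabilityMeasure (μ j)] (j : Fin d) {f : X → ℝ≥0∞} (hf : Measurable f) :
    ∫⁻ x, ENNReal.ofReal (density μ x j) * f x ∂(avg μ) = ∫⁻ x, f x ∂(μ j) := by
  conv_rhs => rw [← withDensity_density hd μ j]
  rw [lintegral_withDensity_eq_lintegral_mul _ (measurable_ofReal_density μ j) hf]
  rfl

theorem lintegral_density_sq_ne_top (hd : 1 ≤ d) (μ : Fin d → Measure X)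
    [∀ j, IsProbabilityMeasure (μ j)] (j : Fin d) :
    ∫⁻ x, ENNReal.ofReal (density μ x j) * ENNReal.ofReal (density μ x j) ∂(avg μ) ≠ ∞ := by
  rw [lintegral_density_mul hd μ j (measurable_ofReal_density μ j)]
  refine ne_top_of_le_ne_top ?_ (lintegral_mono' (le_smul_avg hd μ j) le_rfl)
  rw [lintegral_smul_measure]
  have := lintegral_density_mul hd μ j (f := fun _ => 1) measurable_const
  simp only [mul_one, lintegral_const, measure_univ] at this
  simp [this]

variable {P : Measure (Fin d → ℝ)}

theorem lintegral_densityLaw (μ : Fin d → Measure X) {h : (Fin d → ℝ) → ℝ≥0∞}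
    (hh : Measurable h) : ∫⁻ z, h z ∂(densityLaw μ) = ∫⁻ x, h (density μ x) ∂(avg μ) :=
  lintegral_map hh (measurable_density μ)

/-- Two nonnegative functions with `⟨u, v⟩ = ⟨v, v⟩ = ⟨u, u⟩` are almost everywhere equal. -/
theorem ae_eq_of_lintegral_mul_eq {α : Type*} [MeasurableSpace α] {ρ : Measure α} {u v : α → ℝ}
    (hu : Measurable u) (hv : Measurable v) (hu0 : ∀ a, 0 ≤ u a) (hv0 : ∀ a, 0 ≤ v a)
    (huv : ∫⁻ a, ENNReal.ofReal (u a) * ENNReal.ofReal (v a) ∂ρ =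
      ∫⁻ a, ENNReal.ofReal (v a) * ENNReal.ofReal (v a) ∂ρ)
    (huu : ∫⁻ a, ENNReal.ofReal (u a) * ENNReal.ofReal (u a) ∂ρ =
      ∫⁻ a, ENNReal.ofReal (v a) * ENNReal.ofReal (v a) ∂ρ)
    (hfin : ∫⁻ a, ENNReal.ofReal (v a) * ENNReal.ofReal (v a) ∂ρ ≠ ∞) : u =ᵐ[ρ] v := by
  have key : ∫⁻ a, (ENNReal.ofReal ((u a - v a) ^ 2) +
      2 * (ENNReal.ofReal (u a) * ENNReal.ofReal (v a))) ∂ρ =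
      ∫⁻ a, (ENNReal.ofReal (u a) * ENNReal.ofReal (u a) +
        ENNReal.ofReal (v a) * ENNReal.ofReal (v a)) ∂ρ := by
    refine lintegral_congr fun a => ?_
    have h1 := hu0 a
    have h2 := hv0 a
    have h3 : (2 : ℝ≥0∞) = ENNReal.ofReal 2 := by simp
    rw [h3, ← ENNReal.ofReal_mul h1, ← ENNReal.ofReal_mul h1, ← ENNReal.ofReal_mul h2,
      ← ENNReal.ofReal_mul (show (0 : ℝ) ≤ 2 by norm_num),
      ← ENNReal.ofReal_add (by positivity) (by positivity),
      ← ENNReal.ofReal_add (by positivity) (by positivity)]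
    congr 1
    ring
  rw [lintegral_add_left (by fun_prop), lintegral_add_left (by fun_prop),
    lintegral_const_mul _ (by fun_prop), huv, huu, ← two_mul] at key
  have h0 : ∫⁻ a, ENNReal.ofReal ((u a - v a) ^ 2) ∂ρ = 0 := by
    refine (ENNReal.add_left_inj (ENNReal.mul_ne_top (ENNReal.ofNat_ne_top (n := 2)) hfin)).1 ?_
    rw [key, zero_add]
  rw [lintegral_eq_zero_iff (by fun_prop)] at h0
  filter_upwards [h0] with a ha
  have h1 : (u a - v a) ^ 2 ≤ 0 := ENNReal.ofReal_eq_zero.1 ha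
  exact sub_eq_zero.1 (pow_eq_zero_iff two_ne_zero |>.1 (le_antisymm h1 (sq_nonneg _)))

theorem comp_avg {μ : Fin d → Measure X} {ν : Fin d → Measure Y}
    [∀ j, IsProbabilityMeasure (μ j)] [∀ j, IsProbabilityMeasure (ν j)]
    {κ : Kernel X Y} (hκ : κ ∈ simTransports μ ν) : κ ∘ₘ avg μ = avg ν := by
  have h : ∀ s : Finset (Fin d), κ ∘ₘ (∑ j ∈ s, μ j) = ∑ j ∈ s, ν j := fun s => by
    classical
    induction s using Finset.induction_on with
    | empty => simp
    | insert a s ha ih =>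
      rw [Finset.sum_insert ha, Finset.sum_insert ha, Measure.comp_add, ih, hκ.2]
  rw [avg_eq_smul, avg_eq_smul, Measure.comp_smul, h]

/-- A simultaneous transport almost surely preserves the density vector. -/
theorem density_eq_of_mem_simTransports (hd : 1 ≤ d) {μ : Fin d → Measure X}
    {ν : Fin d → Measure Y} (hμ : μ ∈ eqvClass X P) (hν : ν ∈ eqvClass Y P) {κ : Kernel X Y}
    (hκ : κ ∈ simTransports μ ν) :
    ∀ᵐ p ∂(avg μ ⊗ₘ κ), density μ p.1 = density ν p.2 := by
  have := hμ.1
  have := hν.1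
  have := hκ.1
  have := isProbabilityMeasure_avg hd μ
  have hsnd : ∀ {f : Y → ℝ≥0∞}, Measurable f →
      ∫⁻ p, f p.2 ∂(avg μ ⊗ₘ κ) = ∫⁻ y, f y ∂(avg ν) := fun {f} hf => by
    rw [← comp_avg hκ, ← Measure.snd_compProd, Measure.snd, lintegral_map hf measurable_snd]
  have hfst : ∀ {f : X → ℝ≥0∞}, Measurable f →
      ∫⁻ p, f p.1 ∂(avg μ ⊗ₘ κ) = ∫⁻ x, f x ∂(avg μ) := fun {f} hf => by
    conv_rhs => rw [← Measure.fst_compProd (avg μ) κ, Measure.fst, lintegral_map hf measurable_fst]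
  suffices h : ∀ j, (fun p : X × Y => density μ p.1 j) =ᵐ[avg μ ⊗ₘ κ]
      fun p => density ν p.2 j by
    filter_upwards [ae_all_iff.2 h] with p hp
    exact funext hp
  intro j
  have hμj := measurable_ofReal_density μ j
  have hνj := measurable_ofReal_density ν j
  have hvv := hsnd (hνj.mul hνj)
  refine ae_eq_of_lintegral_mul_eq
    (((measurable_pi_apply j).comp (measurable_density μ)).comp measurable_fst)
    (((measurable_pi_apply j).comp (measurable_density ν)).comp measurable_snd)
    (fun _ => ENNReal.toReal_nonneg) (fun _ => ENNReal.toReal_nonneg) ?_ ?_ ?_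
  · refine Eq.trans ?_ hvv.symm
    simp only [Pi.mul_apply]
    rw [lintegral_density_mul hd ν j hνj, Measure.lintegral_compProd (by fun_prop), ← hκ.2 j,
      Measure.lintegral_bind κ.aemeasurable hνj.aemeasurable,
      ← lintegral_density_mul hd μ j hνj.lintegral_kernel]
    exact lintegral_congr fun x => lintegral_const_mul (ENNReal.ofReal (density μ x j)) hνj
  · refine ((hfst (hμj.mul hμj)).trans ?_).trans hvv.symm
    have hm : Measurable fun z : Fin d → ℝ => ENNReal.ofReal (z j) * ENNReal.ofReal (z j) := by
      fun_prop
    have h1 := lintegral_densityLaw μ hm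
    rw [hμ.2, ← hν.2] at h1
    exact h1.symm.trans (lintegral_densityLaw ν hm)
  · exact hvv.trans_ne (lintegral_density_sq_ne_top hd ν j)

theorem IsDisintegration.ae_density_eq {μ : Fin d → Measure X} {μz : Kernel (Fin d → ℝ) X}
    (h : IsDisintegration μ μz) : ∀ᵐ z ∂(densityLaw μ), ∀ᵐ x ∂(μz z), density μ x = z :=
  h.concentrated

theorem IsDisintegration.lintegral_avg {μ : Fin d → Measure X} {μz : Kernel (Fin d → ℝ) X}
    (h : IsDisintegration μ μz) {f : X → ℝ≥0∞} (hf : Measurable f) :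
    ∫⁻ x, f x ∂(avg μ) = ∫⁻ z, ∫⁻ x, f x ∂(μz z) ∂(densityLaw μ) := by
  rw [h.lintegral_eq f hf]
  refine lintegral_congr_ae ?_
  filter_upwards [h.ae_density_eq] with z hz
  rw [Measure.restrict_eq_self_of_ae_mem (s := slice μ z) hz]

theorem IsDisintegration.comp_densityLaw {μ : Fin d → Measure X} {μz : Kernel (Fin d → ℝ) X}
    (h : IsDisintegration μ μz) : μz ∘ₘ densityLaw μ = avg μ := by
  ext s hs
  rw [Measure.bind_apply hs μz.aemeasurable, ← lintegral_indicator_one hs,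
    h.lintegral_avg (measurable_one.indicator hs)]
  simp only [lintegral_indicator_one hs]

/-- Integrating a function of the slice label and the point. -/
theorem IsDisintegration.lintegral_lintegral {μ : Fin d → Measure X}
    {μz : Kernel (Fin d → ℝ) X} (h : IsDisintegration μ μz) {f : (Fin d → ℝ) → X → ℝ≥0∞}
    (hf : Measurable fun x => f (density μ x) x) :
    ∫⁻ z, ∫⁻ x, f z x ∂(μz z) ∂(densityLaw μ) = ∫⁻ x, f (density μ x) x ∂(avg μ) := by
  rw [h.lintegral_avg hf]
  refine lintegral_congr_ae ?_
  filter_upwards [h.ae_density_eq] with z hz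
  refine lintegral_congr_ae ?_
  filter_upwards [hz] with x hx
  rw [hx]

/-- A simultaneous transport maps almost every slice measure to the corresponding one. -/
theorem ae_mem_transports [MeasurableSpace.CountablyGenerated Y] (hd : 1 ≤ d)
    {μ : Fin d → Measure X} {ν : Fin d → Measure Y}
    (hμ : μ ∈ eqvClass X P) (hν : ν ∈ eqvClass Y P)
    {μz : Kernel (Fin d → ℝ) X} {νz : Kernel (Fin d → ℝ) Y}
    (hμz : IsDisintegration μ μz) (hνz : IsDisintegration ν νz) {κ : Kernel X Y}
    (hκ : κ ∈ simTransports μ ν) : ∀ᵐ z ∂P, κ ∈ transports (μz z) (νz z) := by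
  have := hμ.1
  have := hν.1
  have := hκ.1
  have := hμz.markov
  have := hνz.markov
  have := isProbabilityMeasure_avg hd μ
  have hP : IsProbabilityMeasure P := by
    rw [← hμ.2]
    exact Measure.isProbabilityMeasure_map (measurable_density μ).aemeasurable
  suffices h : P ⊗ₘ (κ ∘ₖ μz) = P ⊗ₘ νz by
    filter_upwards [Kernel.ae_eq_of_compProd_eq h] with z hz
    exact ⟨hκ.1, by rw [← hz, Kernel.comp_apply]⟩
  ext s hs
  have hsx : MeasurableSet {p : X × Y | (density μ p.1, p.2) ∈ s} :=
    hs.preimage (by fun_prop)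
  have hsy : MeasurableSet {y : Y | (density ν y, y) ∈ s} := hs.preimage (by fun_prop)
  have h1 : (P ⊗ₘ (κ ∘ₖ μz)) s = (avg μ ⊗ₘ κ) {p : X × Y | (density μ p.1, p.2) ∈ s} := by
    have hm := Kernel.measurable_kernel_prodMk_left (κ := κ) hsx
    rw [Measure.compProd_apply hs, Measure.compProd_apply hsx]
    refine Eq.trans ?_ (hμz.lintegral_lintegral (f := fun z x => κ x (Prod.mk z ⁻¹' s)) hm)
    rw [hμ.2]
    exact lintegral_congr fun z => Kernel.comp_apply' _ _ _ (measurable_prodMk_left hs)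
  have h2 : (P ⊗ₘ νz) s = avg ν {y : Y | (density ν y, y) ∈ s} := by
    rw [Measure.compProd_apply hs, ← lintegral_indicator_one hsy]
    refine Eq.trans ?_ (hνz.lintegral_lintegral
      (f := fun z y => s.indicator 1 (z, y)) (measurable_one.indicator hsy))
    rw [hν.2]
    exact lintegral_congr fun z => (lintegral_indicator_one (measurable_prodMk_left hs)).symm
  rw [h1, h2, ← comp_avg hκ, ← Measure.snd_compProd, Measure.snd_apply hsy]
  refine measure_congr ?_
  filter_upwards [density_eq_of_mem_simTransports hd hμ hν hκ] with p hp
  exact propext (by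
    change (density μ p.1, p.2) ∈ s ↔ (density ν p.2, p.2) ∈ s
    rw [hp])

theorem cost_eq_lintegral {c : X × Y → ℝ≥0∞} (hc : Measurable c) (η : Measure X) [SFinite η]
    (κ : Kernel X Y) [IsSFiniteKernel κ] :
    cost c η κ = ∫⁻ x, ∫⁻ y, c (x, y) ∂(κ x) ∂η :=
  Measure.lintegral_compProd hc

/-- The cost of a kernel is the mixture of its costs on the slices. -/
theorem IsDisintegration.cost_avg {μ : Fin d → Measure X} {μz : Kernel (Fin d → ℝ) X}
    (hd : 1 ≤ d) [∀ j, IsProbabilityMeasure (μ j)]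
    (h : IsDisintegration μ μz) {c : X × Y → ℝ≥0∞} (hc : Measurable c)
    (κ : Kernel X Y) [IsMarkovKernel κ] :
    cost c (avg μ) κ = ∫⁻ z, cost c (μz z) κ ∂(densityLaw μ) := by
  have := h.markov
  have := isProbabilityMeasure_avg hd μ
  simp only [cost_eq_lintegral hc]
  exact h.lintegral_avg hc.lintegral_kernel_prod_right'

/-- Couplings of the slice measures are glued to a simultaneous transport. -/
theorem exists_simTransport_of_couplings [StandardBorelSpace Y] (hd : 1 ≤ d)
    {μ : Fin d → Measure X} {ν : Fin d → Measure Y}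
    (hμ : μ ∈ eqvClass X P) (hν : ν ∈ eqvClass Y P)
    {μz : Kernel (Fin d → ℝ) X} {νz : Kernel (Fin d → ℝ) Y}
    (hμz : IsDisintegration μ μz) (hνz : IsDisintegration ν νz)
    {π : Kernel (Fin d → ℝ) (X × Y)} [IsMarkovKernel π] (h1 : ∀ z, (π z).fst = μz z)
    (h2 : ∀ z, (π z).snd = νz z) {c : X × Y → ℝ≥0∞} (hc : Measurable c) :
    ∃ κ ∈ simTransports μ ν, cost c (avg μ) κ = ∫⁻ z, ∫⁻ p, c p ∂(π z) ∂P := by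
  have := hμ.1
  have := hν.1
  have := isProbabilityMeasure_avg hd μ
  have := isProbabilityMeasure_avg hd ν
  have : Nonempty Y := (avg ν).nonempty_of_neZero
  have hP : IsProbabilityMeasure P := by
    rw [← hμ.2]
    exact Measure.isProbabilityMeasure_map (measurable_density μ).aemeasurable
  have hfst : (π ∘ₘ P).fst = avg μ := by
    ext s hs
    rw [Measure.fst_apply hs, Measure.bind_apply (measurable_fst hs) π.aemeasurable,
      ← hμz.comp_densityLaw, hμ.2, Measure.bind_apply hs μz.aemeasurable]
    simp only [← h1, Measure.fst_apply hs]
  have hsnd : (π ∘ₘ P).snd = avg ν := by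
    ext s hs
    rw [Measure.snd_apply hs, Measure.bind_apply (measurable_snd hs) π.aemeasurable,
      ← hνz.comp_densityLaw, hν.2, Measure.bind_apply hs νz.aemeasurable]
    simp only [← h2, Measure.snd_apply hs]
  have hden : ∀ᵐ p ∂(π ∘ₘ P), density μ p.1 = density ν p.2 := by
    refine Measure.ae_comp_of_ae_ae (measurableSet_eq_fun (by fun_prop) (by fun_prop)) ?_
    have hμae := hμz.ae_density_eq
    have hνae := hνz.ae_density_eq
    rw [hμ.2] at hμae
    rw [hν.2] at hνae
    filter_upwards [hμae, hνae] with z hz hz'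
    rw [← h1, Measure.fst] at hz
    rw [← h2, Measure.snd] at hz'
    filter_upwards [ae_of_ae_map measurable_fst.aemeasurable hz,
      ae_of_ae_map measurable_snd.aemeasurable hz'] with p hp hp'
    rw [hp, hp']
  have hdis : avg μ ⊗ₘ (π ∘ₘ P).condKernel = π ∘ₘ P := by
    rw [← hfst]
    exact (π ∘ₘ P).disintegrate _
  refine ⟨(π ∘ₘ P).condKernel, ⟨inferInstance, fun j => ?_⟩, ?_⟩
  · ext s hs
    have hμj := measurable_ofReal_density μ j
    have hνj := measurable_ofReal_density ν j
    have hi : Measurable (s.indicator (1 : Y → ℝ≥0∞)) := measurable_one.indicator hs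
    rw [Measure.bind_apply hs (Kernel.aemeasurable _),
      ← lintegral_density_mul hd μ j (Kernel.measurable_coe _ hs)]
    calc ∫⁻ x, ENNReal.ofReal (density μ x j) * (π ∘ₘ P).condKernel x s ∂(avg μ)
        = ∫⁻ p, ENNReal.ofReal (density μ p.1 j) * s.indicator 1 p.2 ∂(π ∘ₘ P) := by
          conv_rhs => rw [← hdis]
          rw [Measure.lintegral_compProd (by fun_prop)]
          refine lintegral_congr fun x => ?_
          exact ((lintegral_const_mul (μ := (π ∘ₘ P).condKernel x)
            (ENNReal.ofReal (density μ x j)) hi).trans (by rw [lintegral_indicator_one hs])).symm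
      _ = ∫⁻ p, ENNReal.ofReal (density ν p.2 j) * s.indicator 1 p.2 ∂(π ∘ₘ P) := by
          refine lintegral_congr_ae ?_
          filter_upwards [hden] with p hp
          rw [hp]
      _ = ∫⁻ y, ENNReal.ofReal (density ν y j) * s.indicator 1 y ∂(avg ν) := by
          rw [← hsnd]
          exact (lintegral_map (hνj.mul hi) measurable_snd).symm
      _ = ν j s := by
          rw [lintegral_density_mul hd ν j hi, lintegral_indicator_one hs]
  · rw [cost, hdis, Measure.lintegral_bind π.aemeasurable hc.aemeasurable]

end Tuple

end SOT

end

theorem theorem4p3 {X Y : Type*}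
    [TopologicalSpace X] [PolishSpace X] [MeasurableSpace X] [BorelSpace X]
    [TopologicalSpace Y] [PolishSpace Y] [MeasurableSpace Y] [BorelSpace Y]
    {d : ℕ} (hd : 1 ≤ d) (c : X × Y → ℝ≥0∞) (hc : Continuous c)
    (P : Measure (Fin d → ℝ))
    (μ : Fin d → Measure X) (ν : Fin d → Measure Y)
    (hμ : μ ∈ SOT.eqvClass X P) (hν : ν ∈ SOT.eqvClass Y P)
    (μz : Kernel (Fin d → ℝ) X) (νz : Kernel (Fin d → ℝ) Y)
    (hμz : SOT.IsDisintegration μ μz) (hνz : SOT.IsDisintegration ν νz) :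
    -- the integral over the slices is well defined
    AEMeasurable (fun z => SOT.minCost c (μz z) (νz z)) P ∧
    (∀ κ ∈ SOT.simTransports μ ν,
      (∀ᵐ z ∂P, κ ∈ SOT.transports (μz z) (νz z)) ∧
      (SOT.IsSimOptimal c μ ν κ ↔
        SOT.cost c (SOT.avg μ) κ = ∫⁻ z, SOT.minCost c (μz z) (νz z) ∂P) ∧
      ((∀ᵐ z ∂P, SOT.IsOptimal c (μz z) (νz z) κ) → SOT.IsSimOptimal c μ ν κ) ∧
      (SOT.simMinCost c μ ν < ∞ →
        List.TFAE [
          SOT.IsSimOptimal c μ ν κ,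
          ∀ᵐ z ∂P, SOT.IsOptimal c (μz z) (νz z) κ,
          SOT.cost c (SOT.avg μ) κ = ∫⁻ z, SOT.minCost c (μz z) (νz z) ∂P])) ∧
    SOT.simMinCost c μ ν = ∫⁻ z, SOT.minCost c (μz z) (νz z) ∂P := by
  have hμ' := hμ.1
  have hν' := hν.1
  have := hμz.markov
  have := hνz.markov
  obtain ⟨π, hπ, h1, h2, hmin⟩ :=
    SOT.exists_coupling_lintegral_eq_minCost hc.lowerSemicontinuous μz νz
  have hcm : Measurable c := hc.measurable
  have hV : Measurable fun z => SOT.minCost c (μz z) (νz z) := by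
    simp only [← hmin]
    exact hcm.lintegral_kernel
  have htr : ∀ κ ∈ SOT.simTransports μ ν, ∀ᵐ z ∂P, κ ∈ SOT.transports (μz z) (νz z) :=
    fun κ hκ => SOT.ae_mem_transports hd hμ hν hμz hνz hκ
  have hcost : ∀ κ ∈ SOT.simTransports μ ν,
      SOT.cost c (SOT.avg μ) κ = ∫⁻ z, SOT.cost c (μz z) κ ∂P := fun κ hκ => by
    have := hκ.1
    rw [hμz.cost_avg hd hcm κ, hμ.2]
  have hle : ∀ κ ∈ SOT.simTransports μ ν,
      ∀ᵐ z ∂P, SOT.minCost c (μz z) (νz z) ≤ SOT.cost c (μz z) κ := fun κ hκ => by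
    filter_upwards [htr κ hκ] with z hz
    exact iInf₂_le κ hz
  have heq : SOT.simMinCost c μ ν = ∫⁻ z, SOT.minCost c (μz z) (νz z) ∂P := by
    refine le_antisymm ?_ (le_iInf₂ fun κ hκ => ?_)
    · obtain ⟨κ, hκ, hκc⟩ :=
        SOT.exists_simTransport_of_couplings hd hμ hν hμz hνz h1 h2 hcm
      refine (iInf₂_le κ hκ).trans_eq (hκc.trans ?_)
      simp only [hmin]
    · rw [hcost κ hκ]
      exact lintegral_mono_ae (hle κ hκ)
  refine ⟨hV.aemeasurable, fun κ hκ => ?_, heq⟩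
  have h13 : SOT.IsSimOptimal c μ ν κ ↔
      SOT.cost c (SOT.avg μ) κ = ∫⁻ z, SOT.minCost c (μz z) (νz z) ∂P := by
    rw [SOT.IsSimOptimal, heq]
    exact and_iff_right hκ
  have h23 : (∀ᵐ z ∂P, SOT.IsOptimal c (μz z) (νz z) κ) →
      SOT.cost c (SOT.avg μ) κ = ∫⁻ z, SOT.minCost c (μz z) (νz z) ∂P := fun h => by
    rw [hcost κ hκ]
    refine lintegral_congr_ae ?_
    filter_upwards [h] with z hz using hz.2
  refine ⟨htr κ hκ, h13, fun h => h13.2 (h23 h), fun hfin => ?_⟩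
  tfae_have 1 ↔ 3 := h13
  tfae_have 2 → 3 := h23
  tfae_have 3 → 2 := fun h => by
    rw [heq] at hfin
    rw [hcost κ hκ] at h
    have := hκ.1
    have hm : Measurable fun z => SOT.cost c (μz z) κ := by
      simp only [SOT.cost_eq_lintegral hcm]
      exact hcm.lintegral_kernel_prod_right'.lintegral_kernel
    filter_upwards [htr κ hκ, ae_eq_of_ae_le_of_lintegral_le (hle κ hκ) hfin.ne hm.aemeasurable
      h.le] with z hz hz'
    exact ⟨hz, hz'.symm⟩
  tfae_finish
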